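/- There is a universal constant $C>0$ such that the following holds for every integer $n\ge 1$ and every probability distribution $\mu$ on $[0,1]^{\mathbb N}$ (coordinates indexed by $j=1,2,\dots$). Write $p(j)=\mathbb E_{X\sim\mu}[X(j)]$ and $\sigma^2(j)=\mathrm{Var}_{X\sim\mu}(X(j))$, and suppose that $\sigma^2(1)\ge\sigma^2(2)\ge\cdots$. For i.i.d. samples $X_1,\dots,X_n\sim\mu$ put $\hat p_n(j)=\frac1n\sum_{i=1}^n X_i(j)$ and $$\Delta_n(\mu)=\mathbb E\,\sup_{j\ge1}\bigl|\hat p_n(j)-p(j)\bigr| .$$ (i) If $\sigma^2(j)\le\frac1{2nj}$ for all $j\ge1$, then $$\Delta_n(\mu)\le C\,\min\left\{\frac1n,\ \sqrt{\frac{\sum_{j\ge1}\sigma^2(j)}{n}}\right\},$$ where the series may be $+\infty$. (ii) Otherwise, $$\Delta_n(\mu)\le C\,\min\left\{1,\ \sup_{j\ge1}\max\left\{\sqrt{\frac{\sigma^2(j)\ln(j+1)}{n}},\ \frac{\ln(j+1)}{n\ln\left(2+\frac{\ln(j+1)}{n\,\sigma^2(j)}\right)}\right\}\right\},$$ where the supremum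 may be $+\infty$, and the second term of the maximum is read as $0$ (its limit) when $\sigma^2(j)=0$. -/

import Mathlib

open MeasureTheory ProbabilityTheory
open scoped ENNReal NNReal

noncomputable section

namespace MaxDeviation

/-- The cube `[0,1]^ℕ` (coordinates `1, 2, 3, …`) with its product `σ`-algebra. -/
abbrev Cube : Type := ℕ+ → unitInterval

/-- The mean `p(j)` of coordinate `j` under `μ`. -/
def coordMean (μ : Measure Cube) (j : ℕ+) : ℝ :=
  ∫ x, (x j : ℝ) ∂μ

/-- The variance `σ²(j)` of coordinate `j` under `μ`. -/
def coordVar (μ : Measure Cube) (j : ℕ+) : ℝ :=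
  variance (fun x : Cube => (x j : ℝ)) μ

/-- Coordinate `j` of the empirical mean of the sample `X 0, …, X (n - 1)`. -/
def empiricalMean {n : ℕ} (X : Fin n → Cube) (j : ℕ+) : ℝ :=
  (∑ i, (X i j : ℝ)) / n

/-- The expected maximum deviation `Δ_n(μ) = 𝔼 sup_j |p̂_n(j) - p(j)|` of the empirical mean of
`n` i.i.d. samples of `μ` from the mean of `μ`. -/
def expectedMaxDeviation (n : ℕ) (μ : Measure Cube) : ℝ≥0∞ :=
  ∫⁻ X : Fin n → Cube, ⨆ j : ℕ+, ENNReal.ofReal |empiricalMean X j - coordMean μ j|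
    ∂(Measure.pi fun _ => μ)

/-- `√(v ln(j+1) / n) ∨ ln(j+1) / (n ln(2 + ln(j+1) / (n v)))`, where the second term is `0`
(its limit) for `v = 0`. -/
def deviationTerm (n : ℕ) (j : ℕ+) (v : ℝ) : ℝ :=
  max (Real.sqrt (v * Real.log ((j : ℝ) + 1) / n))
    (if v = 0 then 0 else
      Real.log ((j : ℝ) + 1) /
        (n * Real.log (2 + Real.log ((j : ℝ) + 1) / (n * v))))

end MaxDeviation

end

namespace MaxDeviation

/-! Write L = ln(j+1) and let S bound every `deviationTerm`. Bennett's inequality, with a suitable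
exponential parameter, shows that the expected excess of |p̂(j) - p(j)| over 5S is at most 6S/(j+1)²
(`lintegral_deviation_excess_le`). These excesses are summable in j, so the expected supremum is at
most a constant times S. Taking S to be the supremum of the terms gives (ii). Under the hypothesis
of (i) every term is at most 1/n, so S = 1/n works. The square-root bound in (i) is a second-moment
argument: the supremum of the squared deviations is at most their sum. -/

/-- For `|z| ≤ 1`, the remainder `exp (θ z) - 1 - θ z` is at most `z²` times its value at `z = 1`. -/
lemma exp_mul_le_of_abs_le_one {θ z : ℝ} (hθ : 0 ≤ θ) (hz : |z| ≤ 1) :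
    Real.exp (θ * z) ≤ 1 + θ * z + z ^ 2 * (Real.exp θ - 1 - θ) := by
  have key : ∀ y : ℝ, HasSum (fun k : ℕ => y ^ (k + 2) / (k + 2).factorial)
      (Real.exp y - 1 - y) := by
    intro y
    have h := NormedSpace.expSeries_div_hasSum_exp (𝔸 := ℝ) y
    rw [← Real.exp_eq_exp_ℝ] at h
    have h2 := (hasSum_nat_add_iff' 2).2 h
    simpa [Finset.sum_range_succ, sub_sub] using h2
  -- The Taylor tails are compared term by term.
  have h := hasSum_le (fun k => ?_) (key (θ * z)) ((key θ).mul_left (z ^ 2))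
  · linarith
  · have h1 : z ^ k ≤ 1 := (le_abs_self _).trans (by
      rw [abs_pow]; exact pow_le_one₀ (abs_nonneg _) hz)
    calc (θ * z) ^ (k + 2) / ((k + 2).factorial : ℝ)
        = z ^ k * (z ^ 2 * (θ ^ (k + 2) / (k + 2).factorial)) := by ring
      _ ≤ 1 * (z ^ 2 * (θ ^ (k + 2) / (k + 2).factorial)) := by gcongr
      _ = _ := one_mul _

/-- Bennett's bound for the exponential moment of a sum of i.i.d. centred bounded variables. -/
lemma integral_exp_sum_le {Ω : Type*} [MeasurableSpace Ω] (μ : Measure Ω) [IsProbabilityMeasure μ]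
    (n : ℕ) {f : Ω → ℝ} (hf : Measurable f) (hb : ∀ x, |f x| ≤ 1) (h0 : ∫ x, f x ∂μ = 0)
    {θ : ℝ} (hθ : 0 ≤ θ) :
    ∫ X : Fin n → Ω, Real.exp (θ * ∑ i, f (X i)) ∂(Measure.pi fun _ => μ) ≤
      Real.exp (n * ((∫ x, f x ^ 2 ∂μ) * (Real.exp θ - 1 - θ))) := by
  have hi : Integrable f μ := .of_bound hf.aestronglyMeasurable 1 (.of_forall hb)
  have hi2 : Integrable (fun x => f x ^ 2) μ := by
    refine .of_bound (hf.pow_const 2).aestronglyMeasurable 1 (.of_forall fun x => ?_)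
    rw [Real.norm_eq_abs, abs_pow]
    exact pow_le_one₀ (abs_nonneg _) (hb x)
  have hone : ∫ x, Real.exp (θ * f x) ∂μ ≤
      Real.exp ((∫ x, f x ^ 2 ∂μ) * (Real.exp θ - 1 - θ)) := by
    have hint : Integrable (fun x => 1 + θ * f x + f x ^ 2 * (Real.exp θ - 1 - θ)) μ :=
      ((integrable_const _).add (hi.const_mul _)).add (hi2.mul_const _)
    have hadd := integral_add ((integrable_const (1 : ℝ)).add (hi.const_mul θ))
      (hi2.mul_const (Real.exp θ - 1 - θ))
    simp only [Pi.add_apply] at hadd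
    calc ∫ x, Real.exp (θ * f x) ∂μ
        ≤ ∫ x, (1 + θ * f x + f x ^ 2 * (Real.exp θ - 1 - θ)) ∂μ :=
          integral_mono_of_nonneg (.of_forall fun x => (Real.exp_pos _).le) hint
            (.of_forall fun x => exp_mul_le_of_abs_le_one hθ (hb x))
      _ = (∫ x, f x ^ 2 ∂μ) * (Real.exp θ - 1 - θ) + 1 := by
          rw [hadd, integral_add (integrable_const _) (hi.const_mul _), integral_const_mul,
            integral_mul_const, h0]
          simp [add_comm]
      _ ≤ _ := Real.add_one_le_exp _
  simp_rw [Finset.mul_sum, Real.exp_sum]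
  rw [integral_fintype_prod_eq_prod (fun _ x => Real.exp (θ * f x)), Finset.prod_const,
    Real.exp_nat_mul, Finset.card_univ, Fintype.card_fin]
  exact pow_le_pow_left₀ (integral_nonneg fun x => (Real.exp_pos _).le) hone n

/-- The numerical heart of the Bennett tail bound: a choice of the exponential parameter. -/
lemma exists_exponential_parameter {n v L S : ℝ} (hn : 0 < n) (hv : 0 < v) (hL : 0 < L)
    (h1 : Real.sqrt (v * L / n) ≤ S) (h2 : L / (n * Real.log (2 + L / (n * v))) ≤ S) :
    ∃ θ : ℝ, 0 < θ ∧ n * (v * (Real.exp θ - 1 - θ)) ≤ n * S * θ ∧ L / 2 ≤ n * S * θ := by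
  set a := L / (n * v) with ha
  have ha0 : 0 < a := by positivity
  set u := Real.sqrt a with hu
  have hu0 : 0 < u := Real.sqrt_pos.2 ha0
  have hua : u ^ 2 = a := Real.sq_sqrt ha0.le
  -- `v * u` equals √(vL/n), the sub-Gaussian term.
  have hvu : v * u ≤ S := by
    refine le_trans (Real.le_sqrt_of_sq_le (le_of_eq ?_)) h1
    rw [mul_pow, hua, ha]
    field_simp
  have hθ0 : 0 < Real.log (1 + u) := Real.log_pos (by linarith)
  -- Equivalent to u - θ ≤ uθ for θ = log(1 + u), which bounds the Bennett exponent by nvuθ ≤ nSθ.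
  have hθu : u ≤ (1 + u) * Real.log (1 + u) := by
    have := Real.one_sub_inv_le_log_of_pos (x := 1 + u) (by linarith)
    have h3 := mul_le_mul_of_nonneg_left this (by linarith : (0 : ℝ) ≤ 1 + u)
    rw [mul_sub, mul_inv_cancel₀ (by linarith)] at h3
    linarith
  refine ⟨Real.log (1 + u), hθ0, ?_, ?_⟩
  · rw [Real.exp_log (by linarith), mul_assoc n]
    refine mul_le_mul_of_nonneg_left ?_ hn.le
    calc v * (1 + u - 1 - Real.log (1 + u)) ≤ v * (u * Real.log (1 + u)) := by
          gcongr; linarith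
      _ = v * u * Real.log (1 + u) := by ring
      _ ≤ _ := by gcongr
  -- For u ≥ 1/2, 2 + u² ≤ (1 + u)², so the logarithmic hypothesis `h2` applies; for smaller u,
  -- log(1 + u) ≥ u/2 and the sub-Gaussian bound suffices.
  · rcases le_or_gt (1 / 2) u with h | h
    · have hlog : Real.log (2 + a) ≤ 2 * Real.log (1 + u) := by
        rw [← Real.log_rpow (by linarith)]
        refine Real.log_le_log (by linarith) ?_
        norm_num
        nlinarith
      have hpos : 0 < Real.log (2 + a) := Real.log_pos (by linarith)
      rw [div_le_iff₀ (by positivity)] at h2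
      have hS : 0 ≤ S := (mul_pos hv hu0).le.trans hvu
      nlinarith [mul_le_mul_of_nonneg_left hlog (mul_nonneg hS hn.le)]
    · have hLa : L = n * v * u ^ 2 := by rw [hua, ha]; field_simp
      have h3 : n * (v * u) * Real.log (1 + u) ≤ n * S * Real.log (1 + u) := by gcongr
      have h4 : u / 2 ≤ Real.log (1 + u) := by nlinarith
      calc L / 2 = n * (v * u) * (u / 2) := by rw [hLa]; ring
        _ ≤ n * (v * u) * Real.log (1 + u) := by gcongr
        _ ≤ _ := h3

/-! ### Moments of the coordinates and of the empirical mean -/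

lemma measurable_coord (j : ℕ+) : Measurable fun x : Cube => (x j : ℝ) :=
  measurable_subtype_coe.comp (measurable_pi_apply j)

lemma measurable_empiricalMean {n : ℕ} (j : ℕ+) :
    Measurable fun X : Fin n → Cube => empiricalMean X j :=
  (Finset.measurable_sum _ fun i _ => (measurable_coord j).comp (measurable_pi_apply i)).div_const _

section

variable (μ : Measure Cube) (j : ℕ+)

lemma integral_coord_sub_sq :
    ∫ x : Cube, ((x j : ℝ) - coordMean μ j) ^ 2 ∂μ = coordVar μ j :=
  (variance_eq_integral (measurable_coord j).aemeasurable).symm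

lemma empiricalMean_sub {n : ℕ} (hn : 1 ≤ n) (X : Fin n → Cube) :
    empiricalMean X j - coordMean μ j = (∑ i, ((X i j : ℝ) - coordMean μ j)) / n := by
  have : (n : ℝ) ≠ 0 := by positivity
  rw [Finset.sum_sub_distrib, empiricalMean]
  simp
  field_simp

lemma measurable_abs_deviation {n : ℕ} :
    Measurable fun X : Fin n → Cube => |empiricalMean X j - coordMean μ j| := by
  have := (measurable_empiricalMean (n := n) j).sub_const (coordMean μ j)
  simpa [Real.norm_eq_abs] using this.norm

variable [IsProbabilityMeasure μ]

lemma memLp_coord : MemLp (fun x : Cube => (x j : ℝ)) 2 μ :=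
  MemLp.of_bound (measurable_coord j).aestronglyMeasurable 1
    (.of_forall fun x => by
      rw [Real.norm_eq_abs, abs_of_nonneg (x j).2.1]; exact (x j).2.2)

lemma integrable_coord : Integrable (fun x : Cube => (x j : ℝ)) μ :=
  (memLp_coord μ j).integrable (by norm_num)

lemma coordMean_mem : coordMean μ j ∈ Set.Icc (0 : ℝ) 1 := by
  refine ⟨integral_nonneg fun x => (x j).2.1, ?_⟩
  have := integral_mono (integrable_coord μ j) (integrable_const (1 : ℝ)) fun x => (x j).2.2
  simpa [coordMean] using this

lemma abs_coord_sub_le (x : Cube) : |(x j : ℝ) - coordMean μ j| ≤ 1 := by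
  have h1 := coordMean_mem μ j
  have h2 := (x j).2
  rw [abs_le]
  exact ⟨by linarith [h1.2, h2.1], by linarith [h1.1, h2.2]⟩

lemma integral_coord_sub : ∫ x : Cube, ((x j : ℝ) - coordMean μ j) ∂μ = 0 := by
  rw [integral_sub (integrable_coord μ j) (integrable_const _)]
  simp [coordMean]

lemma abs_empiricalMean_sub_le {n : ℕ} (hn : 1 ≤ n) (X : Fin n → Cube) :
    |empiricalMean X j - coordMean μ j| ≤ 1 := by
  have : (0 : ℝ) < n := by positivity
  rw [empiricalMean_sub μ j hn, abs_div, abs_of_pos this, div_le_one this]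
  refine (Finset.abs_sum_le_sum_abs _ _).trans ?_
  refine (Finset.sum_le_sum fun i _ => abs_coord_sub_le μ j (X i)).trans ?_
  simp

lemma variance_empiricalMean {n : ℕ} (hn : 1 ≤ n) :
    ∫⁻ X : Fin n → Cube, ENNReal.ofReal |empiricalMean X j - coordMean μ j| ^ 2
      ∂(Measure.pi fun _ => μ) = ENNReal.ofReal (coordVar μ j) / n := by
  have hn0 : (0 : ℝ) < n := by positivity
  have hmeas : Measurable fun x : Cube => (x j : ℝ) - coordMean μ j :=
    (measurable_coord j).sub_const _
  have hL : MemLp (fun x : Cube => (x j : ℝ) - coordMean μ j) 2 μ :=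
    (memLp_coord μ j).sub (memLp_const _)
  have hvar := variance_sum_pi (μ := fun _ : Fin n => μ)
    (X := fun _ (x : Cube) => (x j : ℝ) - coordMean μ j) (fun _ => hL)
  have hsum : (∑ i : Fin n, fun X : Fin n → Cube => (X i j : ℝ) - coordMean μ j) =
      fun X => ∑ i, ((X i j : ℝ) - coordMean μ j) := by ext; simp
  have hm : Measurable fun X : Fin n → Cube => ∑ i, ((X i j : ℝ) - coordMean μ j) :=
    Finset.measurable_sum _ fun i _ => hmeas.comp (measurable_pi_apply i)
  have hmean : ∫ X : Fin n → Cube, ∑ i, ((X i j : ℝ) - coordMean μ j)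
      ∂(Measure.pi fun _ => μ) = 0 := by
    rw [integral_finsetSum]
    · refine Finset.sum_eq_zero fun i _ => ?_
      rw [← integral_coord_sub μ j]
      exact integral_comp_eval (μ := fun _ : Fin n => μ) (i := i) hmeas.aestronglyMeasurable
    · intro i _
      exact integrable_comp_eval (μ := fun _ : Fin n => μ) (i := i) (hL.integrable (by norm_num))
  rw [hsum, variance_eq_integral hm.aemeasurable, hmean,
    variance_sub_const (measurable_coord j).aestronglyMeasurable] at hvar
  simp only [sub_zero, Finset.sum_const, Finset.card_univ, Fintype.card_fin, nsmul_eq_mul] at hvar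
  have hpt : ∀ X : Fin n → Cube, ENNReal.ofReal |empiricalMean X j - coordMean μ j| ^ 2 =
      ENNReal.ofReal ((∑ i, ((X i j : ℝ) - coordMean μ j)) ^ 2 / n ^ 2) := by
    intro X
    rw [← ENNReal.ofReal_pow (abs_nonneg _), sq_abs, empiricalMean_sub μ j hn, div_pow]
  simp_rw [hpt]
  rw [← ofReal_integral_eq_lintegral_ofReal, integral_div, hvar, ← ENNReal.ofReal_natCast,
    ← ENNReal.ofReal_div_of_pos hn0]
  · congr 1
    rw [coordVar]
    field_simp
  · refine .of_bound ((hm.pow_const 2).div_const _).aestronglyMeasurable 1 (.of_forall fun X => ?_)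
    rw [← div_pow, ← empiricalMean_sub μ j hn, Real.norm_eq_abs, abs_pow]
    exact pow_le_one₀ (abs_nonneg _) (abs_empiricalMean_sub_le μ j hn X)
  · exact .of_forall fun X => by positivity

/-- The exponential moments of the deviation, in both directions, shifted by a threshold. -/
lemma integral_exp_deviation_le {n : ℕ} (hn : 1 ≤ n) {s θ : ℝ} (hs : |s| = 1) (hθ : 0 ≤ θ) :
    ∫ X : Fin n → Cube, Real.exp (n * θ * (s * (empiricalMean X j - coordMean μ j)))
      ∂(Measure.pi fun _ => μ) ≤
      Real.exp (n * (coordVar μ j * (Real.exp θ - 1 - θ))) := by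
  have hn0 : (n : ℝ) ≠ 0 := by positivity
  have hs2 : s ^ 2 = 1 := by rw [← sq_abs, hs, one_pow]
  have h := integral_exp_sum_le μ n (f := fun x : Cube => s * ((x j : ℝ) - coordMean μ j))
    (((measurable_coord j).sub_const _).const_mul s)
    (fun x => by rw [abs_mul, hs, one_mul]; exact abs_coord_sub_le μ j x)
    (by rw [integral_const_mul, integral_coord_sub, mul_zero]) hθ
  simp only [mul_pow, hs2, one_mul, integral_coord_sub_sq, ← Finset.mul_sum] at h
  refine le_trans (le_of_eq ?_) h
  congr 1
  ext X
  rw [empiricalMean_sub μ j hn]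
  congr 1
  field_simp

/-- Integrating (x)₊ ≤ exp(nθx)/(nθ) at x = |D| - 5S reduces the excess to the two-sided exponential
moment. -/
lemma lintegral_deviation_excess_le {n : ℕ} (hn : 1 ≤ n) {S : ℝ} (hS : 0 ≤ S)
    (h : deviationTerm n j (coordVar μ j) ≤ S) :
    ∫⁻ X : Fin n → Cube, ENNReal.ofReal (|empiricalMean X j - coordMean μ j| - 5 * S)
      ∂(Measure.pi fun _ => μ) ≤ ENNReal.ofReal (6 / ((j : ℝ) + 1) ^ 2 * S) := by
  have hn0 : (0 : ℝ) < n := by positivity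
  -- With zero variance the deviation vanishes almost surely.
  rcases (variance_nonneg (fun x : Cube => (x j : ℝ)) μ).eq_or_lt with hv | hv
  · change 0 = coordVar μ j at hv
    have h2 := variance_empiricalMean μ j hn
    rw [← hv, ENNReal.ofReal_zero, ENNReal.zero_div, lintegral_eq_zero_iff
      ((measurable_abs_deviation μ j).ennreal_ofReal.pow_const 2)] at h2
    refine le_of_eq_of_le ?_ zero_le
    rw [lintegral_eq_zero_iff ((measurable_abs_deviation μ j).sub_const _).ennreal_ofReal]
    filter_upwards [h2] with X hX
    simp only [Pi.zero_apply, pow_eq_zero_iff, ne_eq, OfNat.ofNat_ne_zero, not_false_eq_true,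
      ENNReal.ofReal_eq_zero] at hX ⊢
    linarith
  change 0 < coordVar μ j at hv
  have hj : (1 : ℝ) ≤ j := by exact_mod_cast (one_le : 1 ≤ j)
  set L := Real.log ((j : ℝ) + 1) with hLdef
  have hL : 2 / 3 ≤ L := by
    have h1 : Real.log 2 ≤ L := Real.log_le_log (by norm_num) (by linarith)
    linarith [Real.log_two_gt_d9]
  have hmax := max_le_iff.1 h
  rw [if_neg hv.ne'] at hmax
  obtain ⟨θ, hθ, hA, hB⟩ := exists_exponential_parameter hn0 hv (by linarith) hmax.1 hmax.2
  set D : (Fin n → Cube) → ℝ := fun X => empiricalMean X j - coordMean μ j with hD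
  have hDm : Measurable D := (measurable_empiricalMean j).sub_const _
  have hDb : ∀ X, |D X| ≤ 1 := abs_empiricalMean_sub_le μ j hn
  have hc : 0 < n * θ := by positivity
  have hint : ∀ s : ℝ, |s| = 1 → Integrable (fun X => Real.exp (n * θ * (s * D X)))
      (Measure.pi fun _ : Fin n => μ) := by
    intro s hs
    refine .of_bound ((hDm.const_mul s).const_mul _).exp.aestronglyMeasurable
      (Real.exp (n * θ * 1)) (.of_forall fun X => ?_)
    rw [Real.norm_eq_abs, Real.abs_exp]
    gcongr
    refine (le_abs_self _).trans ?_
    rw [abs_mul, hs, one_mul]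
    exact hDb X
  set c := Real.exp (-(n * θ * (5 * S))) / (n * θ) with hcdef
  have hc0 : 0 < c := by positivity
  have hpt : ∀ X, |D X| - 5 * S ≤
      c * (Real.exp (n * θ * (1 * D X)) + Real.exp (n * θ * (-1 * D X))) := by
    intro X
    have hx : |D X| - 5 * S ≤ c * Real.exp (n * θ * |D X|) := by
      rw [hcdef, div_mul_eq_mul_div, ← Real.exp_add, le_div_iff₀ hc]
      have := Real.add_one_le_exp (-(n * θ * (5 * S)) + n * θ * |D X|)
      linarith
    refine hx.trans ?_
    gcongr
    rcases abs_choice (D X) with h | h <;> rw [h]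
    · rw [one_mul]; linarith [Real.exp_pos (n * θ * (-1 * D X))]
    · rw [neg_one_mul]; linarith [Real.exp_pos (n * θ * (1 * D X))]
  calc ∫⁻ X, ENNReal.ofReal (|D X| - 5 * S) ∂(Measure.pi fun _ => μ)
      ≤ ∫⁻ X, ENNReal.ofReal (c * (Real.exp (n * θ * (1 * D X)) +
          Real.exp (n * θ * (-1 * D X)))) ∂(Measure.pi fun _ => μ) :=
        lintegral_mono fun X => ENNReal.ofReal_le_ofReal (hpt X)
    _ = ENNReal.ofReal (∫ X, c * (Real.exp (n * θ * (1 * D X)) +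
          Real.exp (n * θ * (-1 * D X))) ∂(Measure.pi fun _ => μ)) :=
        (ofReal_integral_eq_lintegral_ofReal
          (((hint 1 (by simp)).add (hint (-1) (by simp))).const_mul c)
          (.of_forall fun X =>
            mul_nonneg hc0.le (add_pos (Real.exp_pos _) (Real.exp_pos _)).le)).symm
    _ ≤ _ := ENNReal.ofReal_le_ofReal ?_
  rw [integral_const_mul, integral_add (hint 1 (by simp)) (hint (-1) (by simp))]
  have h1 := integral_exp_deviation_le μ j hn (s := 1) (by simp) hθ.le
  have h2 := integral_exp_deviation_le μ j hn (s := -1) (by simp) hθ.le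
  have h3 : Real.exp (n * (coordVar μ j * (Real.exp θ - 1 - θ))) ≤ Real.exp (n * S * θ) :=
    Real.exp_le_exp.2 hA
  -- Of the 5S, one S pays for the exponential moment; the other four give 4nSθ ≥ 2L.
  have hexp : Real.exp (-(n * θ * (5 * S))) * Real.exp (n * S * θ) ≤ 1 / ((j : ℝ) + 1) ^ 2 := by
    rw [← Real.exp_add, one_div, ← Real.exp_log (by positivity : 0 < (((j : ℝ) + 1) ^ 2)⁻¹),
      Real.log_inv, Real.log_pow]
    refine Real.exp_le_exp.2 ?_
    push_cast
    linarith
  -- Here nSθ ≥ L/2 ≥ 1/3, because L ≥ log 2 > 2/3.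
  have hinv : 2 / (n * θ) ≤ 6 * S := by
    rw [div_le_iff₀ hc]
    linarith
  calc _ ≤ c * (Real.exp (n * S * θ) + Real.exp (n * S * θ)) := by
        gcongr
        · exact h1.trans h3
        · exact h2.trans h3
    _ = (2 / (n * θ)) * (Real.exp (-(n * θ * (5 * S))) * Real.exp (n * S * θ)) := by
        rw [hcdef]; ring
    _ ≤ (6 * S) * (1 / ((j : ℝ) + 1) ^ 2) := by gcongr
    _ = _ := by ring

end

/-! ### Bounds on the expected supremum -/

lemma expectedMaxDeviation_le_one {n : ℕ} (hn : 1 ≤ n) (μ : Measure Cube)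
    [IsProbabilityMeasure μ] : expectedMaxDeviation n μ ≤ 1 := by
  calc expectedMaxDeviation n μ ≤ ∫⁻ _ : Fin n → Cube, 1 ∂(Measure.pi fun _ => μ) :=
        lintegral_mono fun X => iSup_le fun j => by
          rw [← ENNReal.ofReal_one]
          exact ENNReal.ofReal_le_ofReal (abs_empiricalMean_sub_le μ j hn X)
    _ = 1 := by simp

lemma expectedMaxDeviation_le_sqrt {n : ℕ} (hn : 1 ≤ n) (μ : Measure Cube)
    [IsProbabilityMeasure μ] :
    expectedMaxDeviation n μ ≤
      ((∑' j : ℕ+, ENNReal.ofReal (coordVar μ j)) / (n : ℝ≥0∞)) ^ (1 / 2 : ℝ) := by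
  set F : (Fin n → Cube) → ℝ≥0∞ :=
    fun X => ⨆ j : ℕ+, ENNReal.ofReal |empiricalMean X j - coordMean μ j| with hF
  have hFm : Measurable F := .iSup fun j => (measurable_abs_deviation μ j).ennreal_ofReal
  -- On a probability space the L¹ norm is at most the L² norm.
  have h := eLpNorm'_le_eLpNorm'_of_exponent_le (f := F) (p := 1) (q := 2) one_pos one_le_two
    (Measure.pi fun _ : Fin n => μ) hFm.aestronglyMeasurable
  simp only [eLpNorm', enorm_eq_self, ENNReal.rpow_one, div_one] at h
  refine h.trans ?_
  gcongr
  calc ∫⁻ X, F X ^ (2 : ℝ) ∂(Measure.pi fun _ => μ)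
      ≤ ∫⁻ X, ∑' j : ℕ+, ENNReal.ofReal |empiricalMean X j - coordMean μ j| ^ 2
          ∂(Measure.pi fun _ => μ) := by
        refine lintegral_mono fun X => ?_
        simp only [hF]
        rw [ENNReal.rpow_two, ENNReal.iSup_pow_of_ne_zero two_ne_zero]
        exact iSup_le fun j => ENNReal.le_tsum j
    _ = ∑' j : ℕ+, ENNReal.ofReal (coordVar μ j) / n := by
        rw [lintegral_tsum fun j =>
          ((measurable_abs_deviation μ j).ennreal_ofReal.pow_const 2).aemeasurable]
        simp_rw [variance_empiricalMean μ _ hn]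
    _ = _ := by simp_rw [div_eq_mul_inv, ENNReal.tsum_mul_right]

lemma summable_six_div_sq : Summable fun j : ℕ+ => 6 / ((j : ℝ) + 1) ^ 2 := by
  have h : Summable fun k : ℕ => 6 / ((k : ℝ) + 1) ^ 2 := by
    have := ((summable_nat_add_iff 1).2 (Real.summable_one_div_nat_pow.2 one_lt_two)).mul_left 6
    simpa [div_eq_mul_inv] using this
  exact h.comp_injective PNat.coe_injective

lemma expectedMaxDeviation_le_of_deviationTerm_le {n : ℕ} (hn : 1 ≤ n) (μ : Measure Cube)
    [IsProbabilityMeasure μ] {S : ℝ} (hS : 0 ≤ S)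
    (h : ∀ j, deviationTerm n j (coordVar μ j) ≤ S) :
    expectedMaxDeviation n μ ≤
      ENNReal.ofReal (5 + ∑' j : ℕ+, 6 / ((j : ℝ) + 1) ^ 2) * ENNReal.ofReal S := by
  calc expectedMaxDeviation n μ
      ≤ ∫⁻ X : Fin n → Cube, (ENNReal.ofReal (5 * S) +
          ∑' j : ℕ+, ENNReal.ofReal (|empiricalMean X j - coordMean μ j| - 5 * S))
          ∂(Measure.pi fun _ => μ) := by
        refine lintegral_mono fun X => iSup_le fun j => ?_
        calc ENNReal.ofReal |empiricalMean X j - coordMean μ j|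
            = ENNReal.ofReal (5 * S + (|empiricalMean X j - coordMean μ j| - 5 * S)) := by
              congr 1; ring
          _ ≤ _ := ENNReal.ofReal_add_le
          _ ≤ _ := by gcongr; exact ENNReal.le_tsum j
    _ = ENNReal.ofReal (5 * S) + ∑' j : ℕ+, ∫⁻ X : Fin n → Cube,
          ENNReal.ofReal (|empiricalMean X j - coordMean μ j| - 5 * S)
          ∂(Measure.pi fun _ => μ) := by
        rw [lintegral_add_left measurable_const, lintegral_tsum fun j =>
          ((measurable_abs_deviation μ j).sub_const _).ennreal_ofReal.aemeasurable]
        simp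
    _ ≤ ENNReal.ofReal (5 * S) + ∑' j : ℕ+, ENNReal.ofReal (6 / ((j : ℝ) + 1) ^ 2 * S) := by
        gcongr with j
        exact lintegral_deviation_excess_le μ j hn hS (h j)
    _ = _ := by
        rw [← ENNReal.ofReal_tsum_of_nonneg (fun j => by positivity)
          (summable_six_div_sq.mul_right S), tsum_mul_right,
          ← ENNReal.ofReal_add (by positivity)
            (mul_nonneg (tsum_nonneg fun j => by positivity) hS),
          ← ENNReal.ofReal_mul (add_nonneg (by norm_num) (tsum_nonneg fun j => by positivity)),
          add_mul]

/-- Since L ≤ j, vL/n ≤ 1/(2n²). Since L ≥ 1/2, L/(nv) ≥ 2jL ≥ j, so the logarithm in the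
denominator is at least L. -/
lemma deviationTerm_le_one_div {n : ℕ} (hn : 1 ≤ n) (j : ℕ+) {v : ℝ} (hv : 0 ≤ v)
    (h : v ≤ 1 / (2 * (n : ℝ) * (j : ℝ))) : deviationTerm n j v ≤ 1 / n := by
  have hn0 : (0 : ℝ) < n := by positivity
  have hj : (1 : ℝ) ≤ j := by exact_mod_cast (one_le : 1 ≤ j)
  have hL1 : Real.log ((j : ℝ) + 1) ≤ j := by
    linarith [Real.log_le_sub_one_of_pos (x := (j : ℝ) + 1) (by linarith)]
  have hL2 : 1 / 2 ≤ Real.log ((j : ℝ) + 1) := by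
    have h1 : Real.log 2 ≤ Real.log ((j : ℝ) + 1) := Real.log_le_log (by norm_num) (by linarith)
    linarith [Real.log_two_gt_d9]
  set L := Real.log ((j : ℝ) + 1) with hL
  have hvj : v * (2 * n * j) ≤ 1 := (le_div_iff₀ (by positivity)).1 h
  refine max_le ?_ ?_
  · refine Real.sqrt_le_iff.2 ⟨by positivity, ?_⟩
    rw [div_pow, div_le_div_iff₀ hn0 (by positivity)]
    have : v * L ≤ v * j := by gcongr
    nlinarith
  · split_ifs with h0
    · positivity
    · have hv0 : 0 < v := lt_of_le_of_ne hv (Ne.symm h0)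
      have hle : (j : ℝ) ≤ L / (n * v) := by
        rw [le_div_iff₀ (by positivity)]
        linarith
      have hlog : L ≤ Real.log (2 + L / (n * v)) := Real.log_le_log (by linarith) (by linarith)
      have hpos : 0 < Real.log (2 + L / (n * v)) := by linarith
      rw [div_le_div_iff₀ (by positivity) hn0]
      nlinarith

end MaxDeviation

theorem corollary5 :
    ∃ C : ℝ≥0, 0 < C ∧
      ∀ (n : ℕ), 1 ≤ n →
      ∀ (μ : Measure MaxDeviation.Cube) [IsProbabilityMeasure μ],
        Antitone (MaxDeviation.coordVar μ) →
        ((∀ j : ℕ+, MaxDeviation.coordVar μ j ≤ 1 / (2 * (n : ℝ) * (j : ℝ))) →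
          MaxDeviation.expectedMaxDeviation n μ ≤
            (C : ℝ≥0∞) * min (1 / (n : ℝ≥0∞))
              (((∑' j : ℕ+, ENNReal.ofReal (MaxDeviation.coordVar μ j)) / (n : ℝ≥0∞))
                ^ (1 / 2 : ℝ))) ∧
        ((¬ ∀ j : ℕ+, MaxDeviation.coordVar μ j ≤ 1 / (2 * (n : ℝ) * (j : ℝ))) →
          MaxDeviation.expectedMaxDeviation n μ ≤
            (C : ℝ≥0∞) * min 1
              (⨆ j : ℕ+, ENNReal.ofReal
                (MaxDeviation.deviationTerm n j (MaxDeviation.coordVar μ j)))) := by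
  have hsum : 0 ≤ ∑' j : ℕ+, 6 / ((j : ℝ) + 1) ^ 2 := tsum_nonneg fun j => by positivity
  set c : ℝ := 5 + ∑' j : ℕ+, 6 / ((j : ℝ) + 1) ^ 2 with hc
  -- The constant also has to absorb the two bounds with constant 1.
  have hC1 : (1 : ℝ≥0∞) ≤ (c.toNNReal : ℝ≥0∞) := by
    change 1 ≤ ENNReal.ofReal c
    rw [ENNReal.one_le_ofReal]
    linarith
  refine ⟨c.toNNReal, Real.toNNReal_pos.2 (by linarith),
    fun n hn μ _ _ => ⟨fun h => ?_, fun _ => ?_⟩⟩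
  · rw [mul_min]
    refine le_min ?_ ?_
    · have hn0 : (0 : ℝ) < n := by positivity
      have := MaxDeviation.expectedMaxDeviation_le_of_deviationTerm_le hn μ (S := 1 / n)
        (by positivity) fun j =>
          MaxDeviation.deviationTerm_le_one_div hn j (variance_nonneg _ _) (h j)
      rwa [ENNReal.ofReal_div_of_pos hn0, ENNReal.ofReal_one, ENNReal.ofReal_natCast] at this
    · exact (MaxDeviation.expectedMaxDeviation_le_sqrt hn μ).trans (le_mul_of_one_le_left' hC1)
  · rw [mul_min, mul_one]
    refine le_min ((MaxDeviation.expectedMaxDeviation_le_one hn μ).trans hC1) ?_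
    set s := ⨆ j : ℕ+, ENNReal.ofReal
      (MaxDeviation.deviationTerm n j (MaxDeviation.coordVar μ j)) with hs
    rcases eq_or_ne s ⊤ with htop | htop
    · rw [htop, ENNReal.mul_top (one_pos.trans_le hC1).ne']
      exact le_top
    · rw [← ENNReal.ofReal_toReal htop]
      refine MaxDeviation.expectedMaxDeviation_le_of_deviationTerm_le hn μ
        ENNReal.toReal_nonneg fun j => ?_
      exact (ENNReal.ofReal_le_iff_le_toReal htop).1 (le_iSup (fun j : ℕ+ => ENNReal.ofReal
        (MaxDeviation.deviationTerm n j (MaxDeviation.coordVar μ j))) j)
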